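/- Let $G$ be a finite-dimensional second countable real Lie group, $\mathbf H$ a complex Hilbert space, and $\rho : G \to U(\mathbf H)$ a unitary representation, i.e. a group homomorphism such that $g \mapsto \rho(g)x$, $G\to\mathbf H$, is continuous for every $x \in \mathbf H$. Let $\mathbf H_\infty \subseteq \mathbf H$ be the linear subspace of smooth vectors, i.e. of those $x$ for which $g \mapsto \rho(g)x$ is a $C^\infty$ map $G \to \mathbf H$. Equip $C^\infty(G,\mathbf H)$ with the compact $C^\infty$-topology (uniform convergence, in charts, on compact sets in all derivatives separately), and $\mathbf H_\infty$ with the topology induced by the embedding $\mathbf H_\infty \to C^\infty(G,\mathbf H)$, $x \mapsto (g \mapsto \rho(g)x)$; this is the usual Fréchet topology of $\mathbf H_\infty$. The subspace $\mathbf H_\infty$ is invariant under $\rho$. Then the action map $\hat\rho : G \times \mathbf H_\infty \to \mathbf H_\infty$, $(g,x) \mapsto \rho(g)x$, is smooth in the sense of Frölicher–Kriegl, i.e. it maps smooth curves to smooth curves: whenever $g : \mathbb R \to G$ is a $C^\infty$ curve in the manifold $G$ and $x : \mathbb R \to \mathbf H_\infty$ is a $C^\infty$ curve (all derivatives exist and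 are continuous in the topology of $\mathbf H_\infty$), the curve $t \mapsto \rho(g(t))x(t)$ in $\mathbf H_\infty$ is $C^\infty$. -/

import Mathlib

open Filter Topology
open scoped Manifold ContDiff

noncomputable section

/-- A curve `c : ℝ → F` in a real topological vector space is smooth if all its derivatives
exist and are continuous: `d n` is the `n`-th derivative of `c`. -/
def IsSmoothCurve {F : Type*} [AddCommGroup F] [Module ℝ F] [TopologicalSpace F]
    (c : ℝ → F) : Prop :=
  ∃ d : ℕ → ℝ → F, d 0 = c ∧ ∀ n : ℕ, Continuous (d n) ∧
    ∀ t : ℝ, Tendsto (fun h : ℝ => h⁻¹ • (d n (t + h) - d n t)) (𝓝[≠] 0) (𝓝 (d (n + 1) t))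

/-- Smoothness in the sense of Frölicher and Kriegl for a map `f : G × V → W`, where `G` is a
finite-dimensional manifold and `V`, `W` are real topological vector spaces: `f` maps smooth
curves to smooth curves. A curve in `G × V` is smooth if and only if both of its components
are smooth. -/
def IsFrolicherKrieglSmooth (E : Type*) [NormedAddCommGroup E] [NormedSpace ℝ E]
    {G : Type*} [TopologicalSpace G] [ChartedSpace E G]
    {V : Type*} [AddCommGroup V] [Module ℝ V] [TopologicalSpace V]
    {W : Type*} [AddCommGroup W] [Module ℝ W] [TopologicalSpace W]
    (f : G × V → W) : Prop :=
  ∀ (g : ℝ → G) (x : ℝ → V), ContMDiff 𝓘(ℝ, ℝ) 𝓘(ℝ, E) ∞ g → IsSmoothCurve x →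
    IsSmoothCurve (fun t => f (g t, x t))

/-- The compact `C^∞`-topology on the space of smooth maps from the manifold `G` to the
normed space `H`: uniform convergence on compact sets in all derivatives separately. For each
chart `φ` of the maximal smooth atlas, each `n`, and each compact subset of the (open) image of
`φ`, the `n`-th derivative of `f ∘ φ⁻¹` has to converge uniformly on that compact subset. -/
instance compactSmoothTopology (E : Type*) [NormedAddCommGroup E] [NormedSpace ℝ E]
    (G : Type*) [TopologicalSpace G] [ChartedSpace E G]
    (H : Type*) [NormedAddCommGroup H] [NormedSpace ℝ H] :
    TopologicalSpace C^∞⟮𝓘(ℝ, E), G; 𝓘(ℝ, H), H⟯ :=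
  ⨅ φ ∈ IsManifold.maximalAtlas 𝓘(ℝ, E) ∞ G, ⨅ n : ℕ,
    TopologicalSpace.induced
      (fun f : C^∞⟮𝓘(ℝ, E), G; 𝓘(ℝ, H), H⟯ =>
        UniformOnFun.ofFun {K : Set E | IsCompact K ∧ K ⊆ φ.target}
          (iteratedFDeriv ℝ n (fun y : E => f (φ.symm y))))
      inferInstance

namespace UnitaryRepresentation

variable (E : Type*) [NormedAddCommGroup E] [NormedSpace ℝ E]
  {G : Type*} [TopologicalSpace G] [ChartedSpace E G] [Group G]
  {H : Type*} [NormedAddCommGroup H] [InnerProductSpace ℂ H] [CompleteSpace H]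
  (ρ : G →* unitary (H →L[ℂ] H))

/-- The linear subspace of smooth vectors: those `x` for which `g ↦ ρ(g)x` is smooth on `G`. -/
def smoothSubspace : Submodule ℂ H where
  carrier := {x : H | ContMDiff 𝓘(ℝ, E) 𝓘(ℝ, H) ∞ (fun g : G => (ρ g : H →L[ℂ] H) x)}
  zero_mem' := by
    simpa using (contMDiff_const : ContMDiff 𝓘(ℝ, E) 𝓘(ℝ, H) ∞ (fun _ : G => (0 : H)))
  add_mem' := by
    intro x y hx hy
    have h : ContDiff ℝ ∞ (fun p : H × H => p.1 + p.2) := contDiff_add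
    simpa [Function.comp_def] using h.contMDiff.comp (ContMDiff.prodMk_space hx hy)
  smul_mem' := by
    intro a x hx
    have h : ContDiff ℝ ∞ (fun y : H => a • y) := contDiff_const_smul a
    simpa [Function.comp_def] using h.contMDiff.comp hx

/-- The space of smooth vectors as a type of its own, so that it does not carry the topology
of a subspace of `H`. -/
def SmoothVectors : Type _ := smoothSubspace E ρ

instance : AddCommGroup (SmoothVectors E ρ) := inferInstanceAs (AddCommGroup (smoothSubspace E ρ))

instance : Module ℂ (SmoothVectors E ρ) := inferInstanceAs (Module ℂ (smoothSubspace E ρ))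

/-- The embedding `x ↦ (g ↦ ρ(g)x)` of the space of smooth vectors into `C^∞(G, H)`. -/
def orbitMap (x : SmoothVectors E ρ) : C^∞⟮𝓘(ℝ, E), G; 𝓘(ℝ, H), H⟯ :=
  ⟨fun g : G => (ρ g : H →L[ℂ] H) x.1, x.2⟩

/-- The topology of the space of smooth vectors is induced from the compact `C^∞`-topology. -/
instance : TopologicalSpace (SmoothVectors E ρ) :=
  TopologicalSpace.induced (orbitMap E ρ) (compactSmoothTopology E G H)

/-- The action `(g, x) ↦ ρ(g)x` of `G` on the space of smooth vectors. -/
def action [LieGroup 𝓘(ℝ, E) ∞ G] (p : G × SmoothVectors E ρ) : SmoothVectors E ρ :=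
  ⟨(ρ p.1 : H →L[ℂ] H) p.2.1, by
    have h := ContMDiff.comp (I' := 𝓘(ℝ, E)) p.2.2
      (contMDiff_mul_right (I := 𝓘(ℝ, E)) (n := ∞) (a := p.1))
    simpa [smoothSubspace, Function.comp_def] using h⟩

end UnitaryRepresentation

end

/-!
The proof rests on an exponential law: a curve `x` of smooth vectors is smooth in the Fréchet
topology of the space of smooth vectors if and only if its orbit map `(h, t) ↦ ρ(h)x(t)` is
smooth on `G × ℝ`. Given this, the theorem follows from the homomorphism property: the orbit map
of `t ↦ ρ(g(t))x(t)` is `(h, t) ↦ ρ(hg(t))x(t)`, the orbit map of `x` composed with the smooth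
map `(h, t) ↦ (hg(t), t)` (`HasJointlySmoothOrbit.action_curve`).

If `x` is smooth, convergence in the compact `C^∞`-topology shows that in a chart all derivatives
in the direction of `G` of the orbit maps of `x` and of its derivatives are jointly continuous
and have time derivatives of the same kind. Iterating the theorem that a function with
continuous partial derivatives is differentiable yields joint smoothness
(`contDiffOn_of_continuousOn_iteratedFDeriv`, `HasJointlySmoothOrbit.of_isSmoothCurve`).

Conversely, let the orbit map of a curve be jointly smooth. As `ρ(h)` is a bounded operator, the
orbit map of the derivative of the curve in `H` is the time derivative of the orbit map, so it is
jointly smooth too, and in particular the derivative consists of smooth vectors. The symmetry of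
second derivatives lets the time derivative pass through the derivatives along `G`
(`hasDerivAt_iteratedFDeriv_space`), and the mean value inequality makes the difference quotients
converge uniformly on compact sets (`tendstoUniformlyOn_slope_of_continuousOn_deriv`,
`HasJointlySmoothOrbit.isSmoothCurve`).
-/

/-! ### Calculus on `U × ℝ` for an open set `U` -/

section Calculus

variable {E W : Type*} [NormedAddCommGroup E] [NormedSpace ℝ E]
  [NormedAddCommGroup W] [NormedSpace ℝ W] {U : Set E} {Φ : ℝ → E → W}

theorem hasFDerivAt_space_of_contDiffOn (hU : IsOpen U)
    (hΦ : ContDiffOn ℝ ∞ (fun p : E × ℝ => Φ p.2 p.1) (U ×ˢ Set.univ)) {y : E} (hy : y ∈ U)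
    (t : ℝ) :
    HasFDerivAt (Φ t) ((fderiv ℝ (fun p : E × ℝ => Φ p.2 p.1) (y, t)).comp
      (ContinuousLinearMap.inl ℝ E ℝ)) y := by
  have h : DifferentiableAt ℝ (fun p : E × ℝ => Φ p.2 p.1) (y, t) :=
    (hΦ.contDiffAt ((hU.prod isOpen_univ).mem_nhds ⟨hy, trivial⟩)).differentiableAt (by simp)
  exact h.hasFDerivAt.comp (f := fun z => (z, t)) y (hasFDerivAt_prodMk_left y t)

theorem hasDerivAt_time_of_contDiffOn (hU : IsOpen U)
    (hΦ : ContDiffOn ℝ ∞ (fun p : E × ℝ => Φ p.2 p.1) (U ×ˢ Set.univ)) {y : E} (hy : y ∈ U)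
    (t : ℝ) :
    HasDerivAt (fun s => Φ s y) (fderiv ℝ (fun p : E × ℝ => Φ p.2 p.1) (y, t) (0, 1)) t := by
  have h : DifferentiableAt ℝ (fun p : E × ℝ => Φ p.2 p.1) (y, t) :=
    (hΦ.contDiffAt ((hU.prod isOpen_univ).mem_nhds ⟨hy, trivial⟩)).differentiableAt (by simp)
  exact h.hasFDerivAt.comp_hasDerivAt (f := fun s => (y, s)) t
    ((hasDerivAt_const t y).prodMk (hasDerivAt_id t))

theorem contDiffOn_fderiv_space (hU : IsOpen U)
    (hΦ : ContDiffOn ℝ ∞ (fun p : E × ℝ => Φ p.2 p.1) (U ×ˢ Set.univ)) :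
    ContDiffOn ℝ ∞ (fun p : E × ℝ => fderiv ℝ (Φ p.2) p.1) (U ×ˢ Set.univ) := by
  have h := hΦ.fderiv_of_isOpen (m := ∞) (hU.prod isOpen_univ) (by simp)
  refine (h.clm_comp (contDiffOn_const (c := ContinuousLinearMap.inl ℝ E ℝ))).congr ?_
  rintro ⟨y, t⟩ ⟨hy, -⟩
  exact (hasFDerivAt_space_of_contDiffOn hU hΦ hy t).fderiv

theorem contDiffOn_deriv_time (hU : IsOpen U)
    (hΦ : ContDiffOn ℝ ∞ (fun p : E × ℝ => Φ p.2 p.1) (U ×ˢ Set.univ)) :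
    ContDiffOn ℝ ∞ (fun p : E × ℝ => deriv (fun s => Φ s p.1) p.2) (U ×ˢ Set.univ) := by
  have h := hΦ.fderiv_of_isOpen (m := ∞) (hU.prod isOpen_univ) (by simp)
  refine (h.clm_apply (contDiffOn_const (c := ((0 : E), (1 : ℝ))))).congr ?_
  rintro ⟨y, t⟩ ⟨hy, -⟩
  exact (hasDerivAt_time_of_contDiffOn hU hΦ hy t).deriv

/-- The derivatives in the space variable and in the time variable commute, by the symmetry of
the second derivative. -/
theorem hasDerivAt_fderiv_space (hU : IsOpen U)
    (hΦ : ContDiffOn ℝ ∞ (fun p : E × ℝ => Φ p.2 p.1) (U ×ˢ Set.univ)) {y : E} (hy : y ∈ U)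
    (t : ℝ) :
    HasDerivAt (fun s => fderiv ℝ (Φ s) y)
      (fderiv ℝ (fun z => deriv (fun s => Φ s z) t) y) t := by
  set F : E × ℝ → W := fun p => Φ p.2 p.1 with hF
  have hat : ContDiffAt ℝ ∞ F (y, t) :=
    hΦ.contDiffAt ((hU.prod isOpen_univ).mem_nhds ⟨hy, trivial⟩)
  have hd : DifferentiableAt ℝ (fderiv ℝ F) (y, t) :=
    (hat.fderiv_right (m := ∞) (by simp)).differentiableAt (by simp)
  have hsymm : IsSymmSndFDerivAt ℝ F (y, t) :=
    hat.isSymmSndFDerivAt (by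
      rw [minSmoothness_of_isRCLikeNormedField]
      exact WithTop.coe_le_coe.2 le_top)
  have h1 : HasDerivAt (fun s => fderiv ℝ F (y, s)) (fderiv ℝ (fderiv ℝ F) (y, t) (0, 1)) t :=
    hd.hasFDerivAt.comp_hasDerivAt (f := fun s => (y, s)) t
      ((hasDerivAt_const t y).prodMk (hasDerivAt_id t))
  have h2 : HasDerivAt (fun s => fderiv ℝ (Φ s) y)
      ((fderiv ℝ (fderiv ℝ F) (y, t) (0, 1)).comp (ContinuousLinearMap.inl ℝ E ℝ)) t := by
    have e : (fun s => fderiv ℝ (Φ s) y) =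
        fun s => (fderiv ℝ F (y, s)).comp (ContinuousLinearMap.inl ℝ E ℝ) :=
      funext fun s => (hasFDerivAt_space_of_contDiffOn hU hΦ hy s).fderiv
    rw [e]
    exact (((ContinuousLinearMap.compL ℝ E (E × ℝ) W).flip
      (ContinuousLinearMap.inl ℝ E ℝ)).hasFDerivAt.comp_hasDerivAt t h1)
  have h3 : HasFDerivAt (fun z => fderiv ℝ F (z, t))
      ((fderiv ℝ (fderiv ℝ F) (y, t)).comp (ContinuousLinearMap.inl ℝ E ℝ)) y :=
    hd.hasFDerivAt.comp (f := fun z => (z, t)) y (hasFDerivAt_prodMk_left y t)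
  have h4 : HasFDerivAt (fun z => deriv (fun s => Φ s z) t)
      ((fderiv ℝ (fderiv ℝ F) (y, t) (0, 1)).comp (ContinuousLinearMap.inl ℝ E ℝ)) y := by
    have h5 := h3.clm_apply (hasFDerivAt_const ((0 : E), (1 : ℝ)) y)
    refine (h5.congr_of_eventuallyEq ?_).congr_fderiv ?_
    · filter_upwards [hU.mem_nhds hy] with z hz
      exact (hasDerivAt_time_of_contDiffOn hU hΦ hz t).deriv
    · ext v
      simpa using hsymm (v, 0) (0, 1)
  rw [h4.fderiv]
  exact h2

theorem contDiffOn_iteratedFDeriv_space (hU : IsOpen U)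
    (hΦ : ContDiffOn ℝ ∞ (fun p : E × ℝ => Φ p.2 p.1) (U ×ˢ Set.univ)) (n : ℕ) :
    ContDiffOn ℝ ∞ (fun p : E × ℝ => iteratedFDeriv ℝ n (Φ p.2) p.1) (U ×ˢ Set.univ) := by
  induction n with
  | zero =>
    exact (continuousMultilinearCurryFin0 ℝ E W).symm.contDiff.comp_contDiffOn hΦ
  | succ n ih =>
    exact (continuousMultilinearCurryLeftEquiv ℝ (fun _ : Fin (n + 1) => E)
      W).symm.contDiff.comp_contDiffOn
      (contDiffOn_fderiv_space (Φ := fun t => iteratedFDeriv ℝ n (Φ t)) hU ih)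

theorem hasDerivAt_iteratedFDeriv_space (hU : IsOpen U)
    (hΦ : ContDiffOn ℝ ∞ (fun p : E × ℝ => Φ p.2 p.1) (U ×ˢ Set.univ)) (n : ℕ) {y : E}
    (hy : y ∈ U) (t : ℝ) :
    HasDerivAt (fun s => iteratedFDeriv ℝ n (Φ s) y)
      (iteratedFDeriv ℝ n (fun z => deriv (fun s => Φ s z) t) y) t := by
  induction n generalizing y with
  | zero =>
    have h := hasDerivAt_time_of_contDiffOn hU hΦ hy t
    rw [← h.deriv] at h
    exact (continuousMultilinearCurryFin0 ℝ E
      W).symm.toContinuousLinearEquiv.hasFDerivAt.comp_hasDerivAt t h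
  | succ n ih =>
    have h := hasDerivAt_fderiv_space (Φ := fun t => iteratedFDeriv ℝ n (Φ t)) hU
      (contDiffOn_iteratedFDeriv_space hU hΦ n) hy t
    have e : (fun z => deriv (fun s => iteratedFDeriv ℝ n (Φ s) z) t) =ᶠ[𝓝 y]
        iteratedFDeriv ℝ n (fun z => deriv (fun s => Φ s z) t) := by
      filter_upwards [hU.mem_nhds hy] with z hz
      exact (ih hz).deriv
    rw [e.fderiv_eq] at h
    exact (continuousMultilinearCurryLeftEquiv ℝ (fun _ : Fin (n + 1) => E)
      W).symm.toContinuousLinearEquiv.hasFDerivAt.comp_hasDerivAt t h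

theorem contDiffOn_succ_of_partial_derivatives {V : Set (E × ℝ)} (hV : IsOpen V) {f : E × ℝ → W}
    {f₁ : E × ℝ → E →L[ℝ] W} {f₂ : E × ℝ → W} {m : ℕ}
    (h₁ : ∀ p ∈ V, HasFDerivAt (fun y => f (y, p.2)) (f₁ p) p.1)
    (h₂ : ∀ p ∈ V, HasDerivAt (fun t => f (p.1, t)) (f₂ p) p.2)
    (hf₁ : ContDiffOn ℝ m f₁ V) (hf₂ : ContDiffOn ℝ m f₂ V) : ContDiffOn ℝ (m + 1) f V := by
  let S : W →L[ℝ] ℝ →L[ℝ] W := ContinuousLinearMap.smulRightL ℝ ℝ W 1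
  have hd : ∀ p ∈ V, HasFDerivAt f ((f₁ p).coprod (S (f₂ p))) p := by
    intro p hp
    refine (hasStrictFDerivAt_uncurry_coprod (𝕜 := ℝ) (f := fun y t => f (y, t))
      (f₁ := fun y t => f₁ (y, t)) (f₂ := fun y t => S (f₂ (y, t))) ?_ ?_ ?_ ?_).hasFDerivAt
    · filter_upwards [hV.mem_nhds hp] with q hq using h₁ q hq
    · filter_upwards [hV.mem_nhds hp] with q hq using (h₂ q hq).hasFDerivAt
    · exact hf₁.continuousOn.continuousAt (hV.mem_nhds hp)
    · exact S.continuous.continuousAt.comp (hf₂.continuousOn.continuousAt (hV.mem_nhds hp))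
  rw [contDiffOn_succ_iff_fderiv_of_isOpen hV]
  refine ⟨fun p hp => (hd p hp).differentiableAt.differentiableWithinAt, by simp, ?_⟩
  have hs₁ : ContDiffOn ℝ m (fun p => (f₁ p).comp (ContinuousLinearMap.fst ℝ E ℝ)) V :=
    hf₁.clm_comp contDiffOn_const
  have hs₂ : ContDiffOn ℝ m (fun p => (S (f₂ p)).comp (ContinuousLinearMap.snd ℝ E ℝ)) V :=
    (S.contDiff.comp_contDiffOn hf₂).clm_comp contDiffOn_const
  refine (hs₁.add hs₂).congr fun p hp => ?_
  rw [(hd p hp).fderiv]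
  ext v <;> simp

/-- Suppose that `F (k + 1)` is the time derivative of `F k` for all `k`, at the level of all
derivatives in the space variable, and that these derivatives are jointly continuous. Then
`F k` is jointly smooth. -/
theorem contDiffOn_of_continuousOn_iteratedFDeriv {F : ℕ → ℝ → E → W} (hU : IsOpen U)
    (hF : ∀ k t, ContDiffOn ℝ ∞ (F k t) U)
    (hcont : ∀ k n, ContinuousOn (fun p : E × ℝ => iteratedFDeriv ℝ n (F k p.2) p.1)
      (U ×ˢ Set.univ))
    (hder : ∀ k n t, ∀ y ∈ U, HasDerivAt (fun s => iteratedFDeriv ℝ n (F k s) y)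
      (iteratedFDeriv ℝ n (F (k + 1) t) y) t) (k : ℕ) :
    ContDiffOn ℝ ∞ (fun p : E × ℝ => F k p.2 p.1) (U ×ˢ Set.univ) := by
  -- The partial derivatives of an `n`-th derivative of `F k` are, up to an isometry, an
  -- `n + 1`-st derivative of `F k` and an `n`-th derivative of `F (k + 1)`, so the order of
  -- differentiability can be raised for all `k` and `n` simultaneously.
  suffices key : ∀ m k n : ℕ, ContDiffOn ℝ m
      (fun p : E × ℝ => iteratedFDeriv ℝ n (F k p.2) p.1) (U ×ˢ Set.univ) by
    refine contDiffOn_infty.2 fun m => ?_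
    exact (continuousMultilinearCurryFin0 ℝ E W).contDiff.comp_contDiffOn (key m k 0)
  intro m
  induction m with
  | zero => exact fun k n => contDiffOn_zero.2 (hcont k n)
  | succ m ih =>
    intro k n
    rw [Nat.cast_succ]
    refine contDiffOn_succ_of_partial_derivatives (hU.prod isOpen_univ)
      (f₁ := fun p => fderiv ℝ (iteratedFDeriv ℝ n (F k p.2)) p.1)
      (fun p hp => ?_) (fun p hp => hder k n p.2 p.1 hp.1) ?_ (ih (k + 1) n)
    · exact (((hF k p.2).contDiffAt (hU.mem_nhds hp.1)).differentiableAt_iteratedFDeriv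
        (by exact_mod_cast ENat.natCast_lt_top n)).hasFDerivAt
    · simp only [fderiv_iteratedFDeriv]
      have hL := LinearIsometryEquiv.contDiff (𝕜 := ℝ) (n := m) (E := E [×(n + 1)]→L[ℝ] W)
        (F := E →L[ℝ] E [×n]→L[ℝ] W)
        (continuousMultilinearCurryLeftEquiv ℝ (fun _ : Fin (n + 1) => E) W)
      exact hL.comp_contDiffOn (ih k (n + 1))

theorem tendstoUniformlyOn_of_continuousOn_prod {X Y : Type*} [TopologicalSpace X]
    [UniformSpace Y] {V K : Set X} {J : X × ℝ → Y} (hJ : ContinuousOn J (V ×ˢ Set.univ))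
    (hK : IsCompact K) (hKV : K ⊆ V) (t : ℝ) :
    TendstoUniformlyOn (fun s y => J (y, s)) (fun y => J (y, t)) (𝓝 t) K := by
  intro u hu
  have hc : ContinuousOn (Function.uncurry fun s y => J (y, s)) (Set.univ ×ˢ K) :=
    hJ.comp continuous_swap.continuousOn fun p hp => ⟨hKV hp.2, trivial⟩
  obtain ⟨v, hv, h⟩ := hK.mem_uniformity_of_prod hc (Set.mem_univ t)
    (symm_le_uniformity hu)
  rw [nhdsWithin_univ] at hv
  filter_upwards [hv] with s hs y hy using h s hs y hy

/-- Difference quotients converge uniformly on compact sets if the time derivative is jointly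
continuous, by the mean value inequality. -/
theorem tendstoUniformlyOn_slope_of_continuousOn_deriv {X : Type*} [TopologicalSpace X]
    {V K : Set X} {J J' : X × ℝ → W} (hJ' : ContinuousOn J' (V ×ˢ Set.univ))
    (hder : ∀ y ∈ V, ∀ t, HasDerivAt (fun s => J (y, s)) (J' (y, t)) t)
    (hK : IsCompact K) (hKV : K ⊆ V) (t : ℝ) :
    TendstoUniformlyOn (fun h y => h⁻¹ • (J (y, t + h) - J (y, t))) (fun y => J' (y, t))
      (𝓝[≠] (0 : ℝ)) K := by
  rw [Metric.tendstoUniformlyOn_iff]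
  intro ε hε
  have hu := Metric.tendstoUniformlyOn_iff.1
    (tendstoUniformlyOn_of_continuousOn_prod hJ' hK hKV t) (ε / 2) (half_pos hε)
  obtain ⟨δ, hδ, hball⟩ := Metric.eventually_nhds_iff_ball.1 hu
  have hne : ∀ᶠ h : ℝ in 𝓝[≠] 0, h ≠ 0 := self_mem_nhdsWithin
  filter_upwards [hne, nhdsWithin_le_nhds (Metric.ball_mem_nhds (0 : ℝ) hδ)] with h h0 hh y hy
  have hmv : ‖(J (y, t + h) - (t + h) • J' (y, t)) - (J (y, t) - t • J' (y, t))‖ ≤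
      ε / 2 * ‖(t + h) - t‖ := by
    -- The function `s ↦ J (y, s) - s • J' (y, t)` has derivative at most `ε / 2` near `t`.
    refine (convex_ball t δ).norm_image_sub_le_of_norm_hasDerivWithin_le
      (f := fun s => J (y, s) - s • J' (y, t)) (f' := fun s => J' (y, s) - J' (y, t))
      (fun s _ => ?_) (fun s hs => ?_) (Metric.mem_ball_self hδ) ?_
    · have := (hder y (hKV hy) s).sub ((hasDerivAt_id s).smul_const (J' (y, t)))
      simpa using! this.hasDerivWithinAt
    · rw [← dist_eq_norm, dist_comm]
      exact (hball s hs y hy).le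
    · simpa [Metric.mem_ball, Real.dist_eq] using hh
  have e : h⁻¹ • (J (y, t + h) - J (y, t)) - J' (y, t) =
      h⁻¹ • ((J (y, t + h) - (t + h) • J' (y, t)) - (J (y, t) - t • J' (y, t))) := by
    have : J' (y, t) = h⁻¹ • h • J' (y, t) := by rw [inv_smul_smul₀ h0]
    rw [add_smul]
    nth_rewrite 1 [this]
    rw [← smul_sub]
    congr 1
    abel
  rw [dist_comm, dist_eq_norm, e, norm_smul, norm_inv]
  rw [add_sub_cancel_left] at hmv
  have hpos : 0 < ‖h‖ := norm_pos_iff.2 h0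
  calc _ ≤ ‖h‖⁻¹ * (ε / 2 * ‖h‖) := by gcongr
    _ = ε / 2 := by field_simp
    _ < ε := half_lt_self hε

end Calculus

/-! ### The topology of the space of smooth vectors -/

namespace UnitaryRepresentation

variable {E : Type*} [NormedAddCommGroup E] [NormedSpace ℝ E]
  {G : Type*} [TopologicalSpace G] [ChartedSpace E G] [Group G]
  {H : Type*} [NormedAddCommGroup H] [InnerProductSpace ℂ H] [CompleteSpace H]
  {ρ : G →* unitary (H →L[ℂ] H)}

theorem tendsto_smoothVectors_iff {ι : Type*} {l : Filter ι} {u : ι → SmoothVectors E ρ}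
    {a : SmoothVectors E ρ} :
    Tendsto u l (𝓝 a) ↔ ∀ φ ∈ IsManifold.maximalAtlas 𝓘(ℝ, E) ∞ G, ∀ (n : ℕ) (K : Set E),
      IsCompact K → K ⊆ φ.target → TendstoUniformlyOn
        (fun i => iteratedFDeriv ℝ n (fun y : E => (ρ (φ.symm y) : H →L[ℂ] H) (u i).1))
        (iteratedFDeriv ℝ n (fun y : E => (ρ (φ.symm y) : H →L[ℂ] H) a.1)) l K := by
  rw [nhds_induced, tendsto_comap_iff]
  simp only [nhds_iInf, tendsto_iInf, nhds_induced, tendsto_comap_iff,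
    UniformOnFun.tendsto_iff_tendstoUniformlyOn, Set.mem_ofPred_eq, and_imp]
  rfl

theorem contDiffOn_orbit_chart {φ : OpenPartialHomeomorph G E}
    (hφ : φ ∈ IsManifold.maximalAtlas 𝓘(ℝ, E) ∞ G) (x : SmoothVectors E ρ) :
    ContDiffOn ℝ ∞ (fun y : E => (ρ (φ.symm y) : H →L[ℂ] H) x.1) φ.target :=
  (ContMDiff.comp_contMDiffOn (I' := 𝓘(ℝ, E)) x.2
    (contMDiffOn_symm_of_mem_maximalAtlas hφ)).contDiffOn

theorem iteratedFDeriv_orbit_smul_sub {φ : OpenPartialHomeomorph G E}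
    (hφ : φ ∈ IsManifold.maximalAtlas 𝓘(ℝ, E) ∞ G) (r : ℝ) (a b : SmoothVectors E ρ) (n : ℕ)
    {y : E} (hy : y ∈ φ.target) :
    iteratedFDeriv ℝ n (fun y : E => (ρ (φ.symm y) : H →L[ℂ] H) (r • (a - b)).1) y =
      r • (iteratedFDeriv ℝ n (fun y : E => (ρ (φ.symm y) : H →L[ℂ] H) a.1) y -
        iteratedFDeriv ℝ n (fun y : E => (ρ (φ.symm y) : H →L[ℂ] H) b.1) y) := by
  have hc (x : SmoothVectors E ρ) :
      ContDiffAt ℝ n (fun y : E => (ρ (φ.symm y) : H →L[ℂ] H) x.1) y :=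
    ((contDiffOn_orbit_chart hφ x).contDiffAt (φ.open_target.mem_nhds hy)).of_le
      (by exact_mod_cast le_top)
  have e : (fun y : E => (ρ (φ.symm y) : H →L[ℂ] H) (r • (a - b)).1) =
      r • ((fun y : E => (ρ (φ.symm y) : H →L[ℂ] H) a.1) -
        (fun y : E => (ρ (φ.symm y) : H →L[ℂ] H) b.1)) := by
    funext z
    have : (r • (a - b)).1 = (r : ℂ) • (a.1 - b.1) := rfl
    simp [this]
  rw [e]
  exact (iteratedFDeriv_const_smul_apply ((hc a).sub (hc b))).trans
    (congrArg (r • ·) (iteratedFDeriv_sub_apply (hc a) (hc b)))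

/-! ### Smooth curves of smooth vectors -/

variable (E ρ) in
/-- The curve `c` in `H` has a jointly smooth orbit map `(h, t) ↦ ρ(h)c(t)` on `G × ℝ`. Joint
smoothness is expressed in the charts of `G`. -/
def HasJointlySmoothOrbit (c : ℝ → H) : Prop :=
  ∀ φ ∈ IsManifold.maximalAtlas 𝓘(ℝ, E) ∞ G, ContDiffOn ℝ ∞
    (fun p : E × ℝ => (ρ (φ.symm p.1) : H →L[ℂ] H) (c p.2)) (φ.target ×ˢ Set.univ)

/-- The orbit map of a smooth curve of smooth vectors is jointly smooth. The space `E` has to be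
locally compact, since convergence is uniform on compact sets only. -/
theorem HasJointlySmoothOrbit.of_isSmoothCurve [FiniteDimensional ℝ E]
    {x : ℝ → SmoothVectors E ρ} (hx : IsSmoothCurve x) :
    HasJointlySmoothOrbit E ρ fun t => (x t).1 := by
  obtain ⟨d, rfl, hd⟩ := hx
  intro φ hφ
  have hpt (y : E) (hy : y ∈ φ.target) : {y} ⊆ φ.target := Set.singleton_subset_iff.2 hy
  refine contDiffOn_of_continuousOn_iteratedFDeriv
    (F := fun k t y => (ρ (φ.symm y) : H →L[ℂ] H) (d k t).1) φ.open_target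
    (fun k t => contDiffOn_orbit_chart hφ (d k t)) (fun k n => ?_) (fun k n t y hy => ?_) 0
  · rintro ⟨y, t⟩ ⟨hy, -⟩
    -- Locally uniform convergence in `t` together with continuity in `y` gives joint continuity.
    obtain ⟨K, hKy, hKφ, hK⟩ :=
      LocallyCompactSpace.local_compact_nhds y _ (φ.open_target.mem_nhds hy)
    have hu := tendsto_smoothVectors_iff.1 ((hd k).1.tendsto t) φ hφ n K hK hKφ
    have hcy : ContinuousAt
        (iteratedFDeriv ℝ n fun z => (ρ (φ.symm z) : H →L[ℂ] H) (d k t).1) y :=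
      (((contDiffOn_orbit_chart hφ (d k t)).contDiffAt
        (φ.open_target.mem_nhds hy)).differentiableAt_iteratedFDeriv
          (by exact_mod_cast ENat.natCast_lt_top n)).continuousAt
    refine ContinuousAt.continuousWithinAt ?_
    rw [Metric.continuousAt_iff']
    intro ε hε
    have h1 := Metric.tendstoUniformlyOn_iff.1 hu (ε / 2) (half_pos hε)
    have h2 := Metric.continuousAt_iff'.1 hcy (ε / 2) (half_pos hε)
    rw [nhds_prod_eq]
    filter_upwards [(Filter.Eventually.and (p := (· ∈ K)) hKy h2).prod_mk h1] with p hp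
    have h3 := hp.2 p.1 hp.1.1
    rw [dist_comm] at h3
    calc _ ≤ _ := dist_triangle _
          (iteratedFDeriv ℝ n (fun z => (ρ (φ.symm z) : H →L[ℂ] H) (d k t).1) p.1) _
      _ < ε / 2 + ε / 2 := add_lt_add h3 hp.1.2
      _ = ε := add_halves ε
  · rw [hasDerivAt_iff_tendsto_slope_zero]
    have h := (tendsto_smoothVectors_iff.1 ((hd k).2 t) φ hφ n {y} isCompact_singleton
      (hpt y hy)).tendsto_at (Set.mem_singleton y)
    simpa only [iteratedFDeriv_orbit_smul_sub hφ _ _ _ n hy] using h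

section Manifold

variable [IsManifold 𝓘(ℝ, E) ∞ G]

/-- The curve is the restriction of its orbit map to the unit of `G`. -/
theorem HasJointlySmoothOrbit.differentiable {c : ℝ → H} (hc : HasJointlySmoothOrbit E ρ c) :
    Differentiable ℝ c := by
  intro t
  have h := hasDerivAt_time_of_contDiffOn (chartAt E (1 : G)).open_target
    (Φ := fun s y => (ρ ((chartAt E (1 : G)).symm y) : H →L[ℂ] H) (c s))
    (hc _ (IsManifold.chart_mem_maximalAtlas (1 : G))) (mem_chart_target E (1 : G)) t
  simp only [(chartAt E (1 : G)).left_inv (mem_chart_source E (1 : G)), map_one] at h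
  exact h.differentiableAt

theorem HasJointlySmoothOrbit.deriv_orbit {c : ℝ → H} (hc : HasJointlySmoothOrbit E ρ c)
    (h : G) (t : ℝ) :
    deriv (fun s => (ρ h : H →L[ℂ] H) (c s)) t = (ρ h : H →L[ℂ] H) (deriv c t) :=
  (((ρ h : H →L[ℂ] H).restrictScalars ℝ).hasFDerivAt.comp_hasDerivAt t
    (hc.differentiable t).hasDerivAt).deriv

theorem HasJointlySmoothOrbit.deriv_curve {c : ℝ → H} (hc : HasJointlySmoothOrbit E ρ c) :
    HasJointlySmoothOrbit E ρ (deriv c) := by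
  intro φ hφ
  have h := contDiffOn_deriv_time φ.open_target
    (Φ := fun s y => (ρ (φ.symm y) : H →L[ℂ] H) (c s)) (hc φ hφ)
  simpa only [hc.deriv_orbit] using h

theorem HasJointlySmoothOrbit.mem_smoothSubspace {c : ℝ → H}
    (hc : HasJointlySmoothOrbit E ρ c) (t : ℝ) : c t ∈ smoothSubspace E ρ := by
  intro h
  let φ := chartAt E h
  have hφ : ContDiffAt ℝ ∞ (fun y : E => (ρ (φ.symm y) : H →L[ℂ] H) (c t)) (φ h) :=
    ((hc φ (IsManifold.chart_mem_maximalAtlas h)).contDiffAt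
      ((φ.open_target.prod isOpen_univ).mem_nhds
        ⟨mem_chart_target E h, Set.mem_univ t⟩)).comp (f := fun y => (y, t)) (φ h)
      (contDiffAt_id.prodMk contDiffAt_const)
  have hm : ContMDiffAt 𝓘(ℝ, E) 𝓘(ℝ, E) ∞ φ h :=
    contMDiffAt_of_mem_maximalAtlas (IsManifold.chart_mem_maximalAtlas h) (mem_chart_source E h)
  refine (hφ.contMDiffAt.comp h hm).congr_of_eventuallyEq ?_
  filter_upwards [φ.open_source.mem_nhds (mem_chart_source E h)] with z hz
  simp [φ.left_inv hz]

/-- The derivatives of the curve in `H` are the derivatives of the curve in the space of smooth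
vectors. -/
theorem HasJointlySmoothOrbit.isSmoothCurve {x : ℝ → SmoothVectors E ρ}
    (hx : HasJointlySmoothOrbit E ρ fun t => (x t).1) : IsSmoothCurve x := by
  have hiter : ∀ k, HasJointlySmoothOrbit E ρ (deriv^[k] fun t => (x t).1) := by
    intro k
    induction k with
    | zero => exact hx
    | succ k ih => rw [Function.iterate_succ_apply']; exact ih.deriv_curve
  obtain ⟨d, hd⟩ : ∃ d : ℕ → ℝ → SmoothVectors E ρ,
      ∀ k, (fun t => (d k t).1) = deriv^[k] fun t => (x t).1 :=
    ⟨fun k t => ⟨_, (hiter k).mem_smoothSubspace t⟩, fun _ => rfl⟩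
  have hk (k : ℕ) : HasJointlySmoothOrbit E ρ fun t => (d k t).1 := hd k ▸ hiter k
  have hsucc (k : ℕ) (t : ℝ) : deriv (fun t => (d k t).1) t = (d (k + 1) t).1 := by
    rw [hd k, ← Function.iterate_succ_apply' deriv, ← hd (k + 1)]
  refine ⟨d, funext fun t => Subtype.ext (congrFun (hd 0) t), fun k => ⟨?_, fun t => ?_⟩⟩
  · refine continuous_iff_continuousAt.2 fun t => ?_
    refine tendsto_smoothVectors_iff.2 fun φ hφ n K hK hKφ => ?_
    exact tendstoUniformlyOn_of_continuousOn_prod (contDiffOn_iteratedFDeriv_space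
      (Φ := fun s y => (ρ (φ.symm y) : H →L[ℂ] H) (d k s).1)
      φ.open_target (hk k φ hφ) n).continuousOn hK hKφ t
  · refine tendsto_smoothVectors_iff.2 fun φ hφ n K hK hKφ => ?_
    have hder (y : E) (hy : y ∈ φ.target) (t : ℝ) : HasDerivAt
        (fun s => iteratedFDeriv ℝ n (fun y => (ρ (φ.symm y) : H →L[ℂ] H) (d k s).1) y)
        (iteratedFDeriv ℝ n (fun y => (ρ (φ.symm y) : H →L[ℂ] H) (d (k + 1) t).1) y) t := by
      have h := hasDerivAt_iteratedFDeriv_space φ.open_target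
        (Φ := fun s y => (ρ (φ.symm y) : H →L[ℂ] H) (d k s).1) (hk k φ hφ) n hy t
      simpa only [(hk k).deriv_orbit, hsucc] using h
    have hu := tendstoUniformlyOn_slope_of_continuousOn_deriv
      (J := fun p : E × ℝ => iteratedFDeriv ℝ n
        (fun y => (ρ (φ.symm y) : H →L[ℂ] H) (d k p.2).1) p.1)
      (contDiffOn_iteratedFDeriv_space φ.open_target
        (Φ := fun s y => (ρ (φ.symm y) : H →L[ℂ] H) (d (k + 1) s).1)
        (hk (k + 1) φ hφ) n).continuousOn hder hK hKφ t
    refine hu.congr (Eventually.of_forall fun h y hy => ?_)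
    exact (iteratedFDeriv_orbit_smul_sub hφ _ _ _ n (hKφ hy)).symm

end Manifold

/-- Since `ρ(h)ρ(g(t))c(t) = ρ(hg(t))c(t)`, the orbit map of `t ↦ ρ(g(t))c(t)` is the composition
of the orbit map of `c` with the smooth map `(h, t) ↦ (hg(t), t)`. -/
theorem HasJointlySmoothOrbit.action_curve [LieGroup 𝓘(ℝ, E) ∞ G] {c : ℝ → H}
    (hc : HasJointlySmoothOrbit E ρ c) {g : ℝ → G} (hg : ContMDiff 𝓘(ℝ, ℝ) 𝓘(ℝ, E) ∞ g) :
    HasJointlySmoothOrbit E ρ fun t => (ρ (g t) : H →L[ℂ] H) (c t) := by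
  rintro φ hφ ⟨y, t⟩ ⟨hy, -⟩
  let ψ := chartAt E (φ.symm y * g t)
  have hψ : ψ ∈ IsManifold.maximalAtlas 𝓘(ℝ, E) ∞ G := IsManifold.chart_mem_maximalAtlas _
  have hsymm : ContMDiffAt 𝓘(ℝ, E × ℝ) 𝓘(ℝ, E) ∞ (fun p : E × ℝ => φ.symm p.1) (y, t) :=
    ((contMDiffOn_symm_of_mem_maximalAtlas hφ).contMDiffAt
      (φ.open_target.mem_nhds hy)).comp (y, t) contDiff_fst.contMDiff.contMDiffAt
  have hgt : ContMDiffAt 𝓘(ℝ, E × ℝ) 𝓘(ℝ, E) ∞ (fun p : E × ℝ => g p.2) (y, t) :=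
    hg.contMDiffAt.comp (y, t) contDiff_snd.contMDiff.contMDiffAt
  have hmul : ContMDiffAt 𝓘(ℝ, E × ℝ) 𝓘(ℝ, E) ∞ (fun p : E × ℝ => φ.symm p.1 * g p.2) (y, t) :=
    hsymm.mul hgt
  have hin : ContMDiffAt 𝓘(ℝ, E × ℝ) 𝓘(ℝ, E) ∞
      (fun p : E × ℝ => ψ (φ.symm p.1 * g p.2)) (y, t) :=
    ContMDiffAt.comp (y, t) (contMDiffAt_of_mem_maximalAtlas hψ (mem_chart_source E _)) hmul
  have hout : ContDiffAt ℝ ∞ (fun p : E × ℝ => (ρ (ψ.symm p.1) : H →L[ℂ] H) (c p.2))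
      (ψ (φ.symm y * g t), t) :=
    (hc ψ hψ).contDiffAt ((ψ.open_target.prod isOpen_univ).mem_nhds
      ⟨mem_chart_target E _, Set.mem_univ t⟩)
  have hcomp := hout.comp (f := fun p : E × ℝ => (ψ (φ.symm p.1 * g p.2), p.2)) (y, t)
    (hin.contDiffAt.prodMk contDiffAt_snd)
  refine ContDiffAt.contDiffWithinAt (hcomp.congr_of_eventuallyEq ?_)
  filter_upwards [hmul.continuousAt (ψ.open_source.mem_nhds (mem_chart_source E _))] with p hp
  have hp' : ψ.symm (ψ (φ.symm p.1 * g p.2)) = φ.symm p.1 * g p.2 := ψ.left_inv hp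
  simp [hp']

end UnitaryRepresentation

theorem theorem5p2
    {E : Type*} [NormedAddCommGroup E] [NormedSpace ℝ E] [FiniteDimensional ℝ E]
    {G : Type*} [TopologicalSpace G] [T2Space G] [SecondCountableTopology G] [ChartedSpace E G]
    [Group G] [LieGroup 𝓘(ℝ, E) ∞ G]
    {H : Type*} [NormedAddCommGroup H] [InnerProductSpace ℂ H] [CompleteSpace H]
    (ρ : G →* unitary (H →L[ℂ] H))
    (hρ : ∀ x : H, Continuous fun g : G => (ρ g : H →L[ℂ] H) x) :
    IsFrolicherKrieglSmooth E (UnitaryRepresentation.action E ρ) := by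
  intro g x hg hx
  exact ((UnitaryRepresentation.HasJointlySmoothOrbit.of_isSmoothCurve hx).action_curve
    hg).isSmoothCurve
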